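/- For a nonnegative real matrix $M$, the nonnegative rank $\mathrm{nnegrk}(M)$ is the least $r$ such that $M=TU$ for entrywise nonnegative real matrices $T$ with $r$ columns and $U$ with $r$ rows (so it is $0$ for $M=0$). For $n\in\mathbb{N}$ and $\rho\in\mathbb{R}$, call an entrywise nonnegative real $2^n\times 2^n$ matrix $M$, with rows and columns indexed by the subsets of $[n]=\{1,\dots,n\}$, a $\rho$-extension of UDISJ (the unique disjointness matrix) if $M_{ab}=\rho$ whenever $a\cap b=\emptyset$ and $M_{ab}=\rho-1$ whenever $|a\cap b|=1$; the remaining entries are arbitrary nonnegative reals. (1) If $\rho$ is a fixed constant, then every $\rho$-extension $M$ of UDISJ satisfies $\mathrm{nnegrk}(M)=2^{\Omega(n)}$. That is, for every $\rho\in\mathbb{R}$ there are $c>0$ and $n_0$, depending only on $\rho$, such that for all $n\ge n_0$ every $\rho$-extension $M$ of UDISJ of size $2^n\times 2^n$ satisfies $\mathrm{nnegrk}(M)\ge 2^{cn}$. (2) If $\rho=O(n^\beta)$ for some constant $\beta<1/2$, then every $\rho$-extension $M$ of UDISJ satisfies $\mathrm{nnegrk}(M)=2^{\Omega(n^{1-2\beta})}$.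 That is, for every $\beta<1/2$ and every $C$ there are $c>0$ and $n_0$, depending only on $\beta$ and $C$, such that for all $n\ge n_0$, all $\rho\le Cn^\beta$ and every $\rho$-extension $M$ of UDISJ of size $2^n\times 2^n$, $\mathrm{nnegrk}(M)\ge 2^{cn^{1-2\beta}}$. -/

import Mathlib

/-- `M` has a nonnegative factorization of rank `r`: `M = T * U` with `T`, `U` entrywise
nonnegative, `T` having `r` columns and `U` having `r` rows. -/
def HasNonnegFactorization {m n : Type*} (M : Matrix m n ℝ) (r : ℕ) : Prop :=
  ∃ (T : Matrix m (Fin r) ℝ) (U : Matrix (Fin r) n ℝ),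
    (∀ i k, 0 ≤ T i k) ∧ (∀ k j, 0 ≤ U k j) ∧ M = T * U

/-- The nonnegative rank of `M`: the minimum rank of a nonnegative factorization. It is meant for
entrywise nonnegative matrices with finitely many rows, which always have such a factorization.
The zero matrix has nonnegative rank `0`. -/
noncomputable def nonnegRank {m n : Type*} (M : Matrix m n ℝ) : ℕ :=
  sInf {r : ℕ | HasNonnegFactorization M r}

/-- For a nonnegative matrix with finitely many rows the minimum defining the nonnegative rank is
over a nonempty set, hence attained. -/
theorem hasNonnegFactorization_nonnegRank {m n : Type*} [Fintype m] (M : Matrix m n ℝ)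
    (hM : ∀ i j, 0 ≤ M i j) : HasNonnegFactorization M (nonnegRank M) := by
  classical
  have hne : {r : ℕ | HasNonnegFactorization M r}.Nonempty := by
    refine ⟨Fintype.card m,
      (1 : Matrix m m ℝ).submatrix id (Fintype.equivFin m).symm,
      M.submatrix (Fintype.equivFin m).symm id, ?_, fun k j => hM _ _, ?_⟩
    · intro i k
      simp only [Matrix.submatrix_apply, Matrix.one_apply]
      split_ifs <;> norm_num
    · rw [Matrix.submatrix_mul_equiv]
      simp
  exact Nat.sInf_mem hne

/-- A real `2^n × 2^n` matrix, rows and columns indexed by the subsets of an `n`-element set, is a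
`ρ`-extension of the unique disjointness matrix if its entry is `ρ` at disjoint pairs and `ρ - 1`
at pairs meeting in exactly one element; the other entries are unconstrained. -/
def IsUDISJExtension (n : ℕ) (ρ : ℝ) (M : Matrix (Finset (Fin n)) (Finset (Fin n)) ℝ) : Prop :=
  (∀ a b, (a ∩ b).card = 0 → M a b = ρ) ∧ (∀ a b, (a ∩ b).card = 1 → M a b = ρ - 1)

open scoped BigOperators

/-! ### Entropy and independence on the cube. -/

section Cube

variable {ι : Type*} [Fintype ι] [DecidableEq ι]

/-! An information-cost argument gives `log r ≥ n / (16 ρ)`. Scaled by `ρ`, a factorization makes `i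
↦ T a i * v i b` a probability distribution for each disjoint pair. Fix `d`, draw `c` uniformly and
use the pair `(c ∩ d, c \ d)`: the index `i` carries at most `log r` information on `c`
(`sum_entropy_le_log`), and at least the sum of its informations on single coordinates
(`sum_twoPointEnt_le`). Coordinate `j` toggles `a` or `b` according as `j ∈ d` or not. Both toggles
together cost order `1 / ρ`, since averages of rank-one terms stay rank-one
(`expect_inter_mul_sdiff`) and the total mass drops by `1 / ρ` when `j` is in both sets
(`half_le_sum_sq_sqrt_sub_sqrt`). Averaging over `d` and summing over `j` finishes. -/

theorem expect_eq_insert_erase (F : Finset ι → ℝ) (j : ι) :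
    𝔼 c, F c = (𝔼 c, F (insert j c) + 𝔼 c, F (Finset.erase c j)) / 2 := by
  have h1 : ∀ c : Finset ι, F (insert j c) + F (Finset.erase c j) = F c + F (symmDiff c {j}) := by
    intro c
    by_cases hj : j ∈ c
    · have : symmDiff c {j} = Finset.erase c j := by
        ext x; simp only [Finset.mem_symmDiff, Finset.mem_singleton, Finset.mem_erase]
        by_cases hx : x = j <;> simp [hx, hj]
      rw [this, Finset.insert_eq_of_mem hj]
    · have : symmDiff c {j} = insert j c := by
        ext x; simp only [Finset.mem_symmDiff, Finset.mem_singleton, Finset.mem_insert]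
        by_cases hx : x = j <;> simp [hx, hj]
      rw [this, Finset.erase_eq_of_notMem hj, add_comm]
  have h2 : 𝔼 c, F (symmDiff c {j}) = 𝔼 c, F c :=
    Fintype.expect_equiv (symmDiff_left_involutive {j}).toPerm _ _ fun c => rfl
  rw [← Finset.expect_add_distrib, Finset.expect_congr rfl fun c _ => h1 c,
    Finset.expect_add_distrib, h2]
  ring

/-- On the cube, the restrictions of a uniformly random set to `d` and to its complement are
independent. -/
theorem expect_inter_mul_sdiff (f g : Finset ι → ℝ) (d : Finset ι) :
    𝔼 c, f (c ∩ d) * g (c \ d) = (𝔼 c, f (c ∩ d)) * 𝔼 c, g (c \ d) := by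
  -- Two independent copies exchange their parts outside `d`.
  have hinv : Function.Involutive (fun p : Finset ι × Finset ι =>
      ((p.1 ∩ d) ∪ (p.2 \ d), (p.2 ∩ d) ∪ (p.1 \ d))) := by
    rintro ⟨a, b⟩
    ext x <;> simp <;> tauto
  have key : ∑ p : Finset ι × Finset ι, f (p.1 ∩ d) * g (p.2 \ d)
      = ∑ p : Finset ι × Finset ι, f (p.1 ∩ d) * g (p.1 \ d) := by
    refine Fintype.sum_equiv hinv.toPerm _ _ ?_
    rintro ⟨a, b⟩
    congr 2 <;> ext x <;> simp only [Function.Involutive.coe_toPerm, Finset.mem_inter,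
      Finset.mem_union, Finset.mem_sdiff] <;> tauto
  rw [Fintype.sum_prod_type, Fintype.sum_prod_type] at key
  simp only [Finset.sum_const, ← Finset.mul_sum, ← Finset.sum_mul, nsmul_eq_mul] at key
  simp only [Finset.expect_eq_sum_div_card]
  rw [div_mul_div_comm, key]
  have : ((Finset.univ : Finset (Finset ι)).card : ℝ) ≠ 0 := by simp
  field_simp

theorem sub_le_mul_log_sub {x y : ℝ} (hx : 0 < x) (hy : 0 < y) :
    x - y ≤ x * Real.log x - x * Real.log y := by
  have h := Real.log_le_sub_one_of_pos (div_pos hy hx)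
  rw [Real.log_div hy.ne' hx.ne'] at h
  have := mul_le_mul_of_nonneg_left h hx.le
  have e : x * (y / x - 1) = y - x := by field_simp
  linarith

/-- The entropy of a function taking the values `x` and `y` with probability `1 / 2` each. -/
noncomputable def twoPointEnt (x y : ℝ) : ℝ :=
  (x * Real.log x + y * Real.log y) / 2 - (x + y) / 2 * Real.log ((x + y) / 2)

/-- Turns information into squared Hellinger distance, to which cut and paste applies. -/
theorem sq_sqrt_sub_sqrt_le_twoPointEnt {x y : ℝ} (hx : 0 ≤ x) (hy : 0 ≤ y) :
    (√x - √y) ^ 2 / 4 ≤ twoPointEnt x y := by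
  have key : ∀ a b : ℝ, 0 ≤ a → 0 < b →
      2 * a ^ 2 - 2 * a * b ≤ a ^ 2 * Real.log (a ^ 2) - a ^ 2 * Real.log (b ^ 2) := by
    intro a b ha hb
    rcases ha.eq_or_lt with rfl | ha
    · simp
    · have := mul_le_mul_of_nonneg_left (sub_le_mul_log_sub ha hb) ha.le
      rw [Real.log_pow, Real.log_pow]
      push_cast
      nlinarith
  obtain ⟨a, ha, rfl⟩ : ∃ a, 0 ≤ a ∧ x = a ^ 2 := ⟨√x, Real.sqrt_nonneg _, (Real.sq_sqrt hx).symm⟩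
  obtain ⟨b, hb, rfl⟩ : ∃ a, 0 ≤ a ∧ y = a ^ 2 := ⟨√y, Real.sqrt_nonneg _, (Real.sq_sqrt hy).symm⟩
  rw [Real.sqrt_sq ha, Real.sqrt_sq hb]
  unfold twoPointEnt
  obtain ⟨m, hm, hme⟩ : ∃ m, 0 ≤ m ∧ (a ^ 2 + b ^ 2) / 2 = m ^ 2 :=
    ⟨√((a ^ 2 + b ^ 2) / 2), Real.sqrt_nonneg _, (Real.sq_sqrt (by positivity)).symm⟩
  rcases hm.eq_or_lt with rfl | hm
  · have ha0 : a = 0 := by nlinarith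
    have hb0 : b = 0 := by nlinarith
    simp [ha0, hb0]
  · have h1 := key a m ha hm
    have h2 := key b m hb hm
    rw [hme]
    have h3 : m ^ 2 * Real.log (m ^ 2)
        = (a ^ 2 * Real.log (m ^ 2) + b ^ 2 * Real.log (m ^ 2)) / 2 := by rw [← hme]; ring
    rw [h3]
    -- With `s = (a + b) / 2`, `m ^ 2 - s ^ 2 = (a - b) ^ 2 / 4`, so the slack is `(m - s) ^ 2`.
    nlinarith [sq_nonneg (m - (a + b) / 2)]

/-- Entropy on the cube is superadditive over the coordinates. -/
theorem sum_twoPointEnt_le (f : Finset ι → ℝ) (hf : ∀ c, 0 ≤ f c) :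
    ∑ j, twoPointEnt (𝔼 c, f (insert j c)) (𝔼 c, f (Finset.erase c j))
      ≤ 𝔼 c, f c * Real.log (f c) - (𝔼 c, f c) * Real.log (𝔼 c, f c) := by
  set m := 𝔼 c, f c with hm
  have hm0 : 0 ≤ m := Finset.expect_nonneg fun c _ => hf c
  rcases hm0.eq_or_lt with h0 | hmpos
  · have hz : ∀ c, f c = 0 := by
      intro c
      have h := (Finset.expect_eq_zero_iff_of_nonneg (fun c _ => hf c)).1 (hm.symm.trans h0.symm)
      exact h c (Finset.mem_univ c)
    simp [hz, twoPointEnt, ← h0]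
  set f1 : ι → ℝ := fun j => 𝔼 c, f (insert j c) with hf1
  set f0 : ι → ℝ := fun j => 𝔼 c, f (Finset.erase c j) with hf0
  have hsplit : ∀ j, m = (f1 j + f0 j) / 2 := fun j => expect_eq_insert_erase f j
  have f1nn : ∀ j, 0 ≤ f1 j := fun j => Finset.expect_nonneg fun c _ => hf _
  have f0nn : ∀ j, 0 ≤ f0 j := fun j => Finset.expect_nonneg fun c _ => hf _
  -- Gibbs' inequality will compare `f` with the product of its one-coordinate marginals, rescaled
  -- to mean `m`.
  let h : ι → Finset ι → ℝ := fun j c => if j ∈ c then f1 j else f0 j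
  have hnn : ∀ j c, 0 ≤ h j c := by
    intro j c; simp only [h]; split_ifs <;> simp [f1nn, f0nn]
  have hpos : ∀ j c, 0 < f c → 0 < h j c := by
    intro j c hc
    simp only [h]
    split_ifs with hj
    · refine Finset.expect_pos' (fun c _ => hf _) ⟨c, Finset.mem_univ c, ?_⟩
      rwa [Finset.insert_eq_of_mem hj]
    · refine Finset.expect_pos' (fun c _ => hf _) ⟨c, Finset.mem_univ c, ?_⟩
      rwa [Finset.erase_eq_of_notMem hj]
  have hg : 𝔼 c, m * ∏ j, (h j c / m) = m := by
    rw [← Finset.mul_expect, Finset.expect_eq_sum_div_card]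
    have e1 : ∑ c : Finset ι, ∏ j, (h j c / m) = ∏ j, (f1 j / m + f0 j / m) := by
      rw [Finset.prod_add, Finset.powerset_univ]
      refine Finset.sum_congr rfl fun c _ => ?_
      rw [← Finset.prod_mul_prod_compl c, ← Finset.compl_eq_univ_sdiff]
      congr 1
      · exact Finset.prod_congr rfl fun j hj => by simp [h, hj]
      · exact Finset.prod_congr rfl fun j hj => by simp [h, Finset.mem_compl.1 hj]
    have e2 : ∀ j, f1 j / m + f0 j / m = 2 := by
      intro j
      rw [← add_div, div_eq_iff hmpos.ne']
      linarith [hsplit j]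
    rw [e1, Finset.prod_congr rfl fun j _ => e2 j]
    simp
  have point : ∀ c, f c * Real.log m + ∑ j, (f c * Real.log (h j c) - f c * Real.log m)
      + f c - m * ∏ j, (h j c / m) ≤ f c * Real.log (f c) := by
    intro c
    rcases (hf c).eq_or_lt with h0 | hc
    · have : 0 ≤ m * ∏ j, (h j c / m) :=
        mul_nonneg hm0 (Finset.prod_nonneg fun j _ => div_nonneg (hnn j c) hm0)
      simp only [← h0, zero_mul, sub_zero, Finset.sum_const_zero, add_zero]
      linarith
    · have hp : ∀ j ∈ Finset.univ, 0 < h j c / m := fun j _ => div_pos (hpos j c hc) hmpos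
      have := sub_le_mul_log_sub hc (mul_pos hmpos (Finset.prod_pos hp))
      rw [Real.log_mul hmpos.ne' (Finset.prod_pos hp).ne', Real.log_prod fun j hj => (hp j hj).ne',
        mul_add, Finset.mul_sum] at this
      have e : ∀ j ∈ Finset.univ, f c * Real.log (h j c / m)
          = f c * Real.log (h j c) - f c * Real.log m := by
        intro j _
        rw [Real.log_div (hpos j c hc).ne' hmpos.ne', mul_sub]
      rw [Finset.sum_congr rfl e] at this
      linarith
  have havg : ∀ j, 𝔼 c, (f c * Real.log (h j c) - f c * Real.log m)
      = twoPointEnt (f1 j) (f0 j) := by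
    intro j
    rw [Finset.expect_sub_distrib, ← Finset.expect_mul, ← hm,
      expect_eq_insert_erase (fun c => f c * Real.log (h j c)) j]
    simp only [h, Finset.mem_insert_self, if_true, Finset.notMem_erase, if_false]
    rw [← Finset.expect_mul, ← Finset.expect_mul, twoPointEnt, ← hsplit j]
  have := Finset.expect_le_expect (s := Finset.univ) fun c _ => point c
  rw [Finset.expect_sub_distrib, Finset.expect_add_distrib, Finset.expect_add_distrib, hg, ← hm,
    ← Finset.expect_mul, ← hm, Finset.expect_sum_comm, Finset.sum_congr rfl fun j _ => havg j]
    at this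
  linarith

end Cube

/-! ### Information bound, cut and paste. -/

/-- The mutual information between a uniform set and an index with `r` values is at most
`log r`. -/
theorem sum_entropy_le_log {ι : Type*} [Fintype ι] {r : ℕ} (w : Fin r → ι → ℝ) [Nonempty ι]
    (hw : ∀ i c, 0 ≤ w i c) (hsum : ∀ c, ∑ i, w i c = 1) :
    ∑ i, (𝔼 c, w i c * Real.log (w i c) - (𝔼 c, w i c) * Real.log (𝔼 c, w i c))
      ≤ Real.log r := by
  have hr : 0 < (r : ℝ) := by
    rcases Nat.eq_zero_or_pos r with rfl | hr
    · simpa using hsum (Classical.arbitrary ι)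
    · exact_mod_cast hr
  have h1 : ∀ i, 𝔼 c, w i c * Real.log (w i c) ≤ 0 := by
    intro i
    rw [← Finset.expect_const (s := (Finset.univ : Finset ι)) Finset.univ_nonempty (0 : ℝ)]
    refine Finset.expect_le_expect fun c _ => ?_
    refine mul_nonpos_of_nonneg_of_nonpos (hw i c) (Real.log_nonpos (hw i c) ?_)
    rw [← hsum c]
    exact Finset.single_le_sum (f := fun i => w i c) (fun i _ => hw i c) (Finset.mem_univ i)
  -- Gibbs' inequality against the uniform weight `1 / r`; the corrections cancel in the sum over
  -- `i`.
  have h2 : ∀ i, -((𝔼 c, w i c) * Real.log (𝔼 c, w i c))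
      ≤ (𝔼 c, w i c) * Real.log r + (1 / r - 𝔼 c, w i c) := by
    intro i
    have hm : 0 ≤ 𝔼 c, w i c := Finset.expect_nonneg fun c _ => hw i c
    rcases hm.eq_or_lt with h0 | hm
    · rw [← h0]; simp
    · have := sub_le_mul_log_sub hm (one_div_pos.2 hr)
      rw [one_div, Real.log_inv] at this
      rw [one_div]
      linarith
  have h3 : ∑ i, 𝔼 c, w i c = 1 := by
    rw [← Finset.expect_sum_comm, Finset.expect_congr rfl fun c _ => hsum c]
    exact Finset.expect_const Finset.univ_nonempty 1
  calc _ ≤ ∑ i, ((𝔼 c, w i c) * Real.log r + (1 / r - 𝔼 c, w i c)) :=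
        Finset.sum_le_sum fun i _ => by linarith [h1 i, h2 i]
    _ = Real.log r := by
        rw [Finset.sum_add_distrib, ← Finset.sum_mul, Finset.sum_sub_distrib, h3]
        simp [hr.ne']

/-- Cut and paste: a `2 × 2` block of rank-one matrices, whose sum is `1` in three entries and
`1 - ε` in the fourth, forces a Hellinger distance between the neighbouring entries. -/
theorem half_le_sum_sq_sqrt_sub_sqrt {κ : Type*} [Fintype κ] (f0 f1 g0 g1 : κ → ℝ) (ε : ℝ)
    (hf0 : ∀ i, 0 ≤ f0 i) (hf1 : ∀ i, 0 ≤ f1 i) (hg0 : ∀ i, 0 ≤ g0 i) (hg1 : ∀ i, 0 ≤ g1 i)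
    (h00 : ∑ i, f0 i * g0 i = 1) (h01 : ∑ i, f0 i * g1 i = 1) (h10 : ∑ i, f1 i * g0 i = 1)
    (h11 : ∑ i, f1 i * g1 i = 1 - ε) :
    ε / 2 ≤ ∑ i, ((√(f0 i * g1 i) - √(f0 i * g0 i)) ^ 2
      + (√(f1 i * g0 i) - √(f0 i * g0 i)) ^ 2) := by
  have key : ∀ i, (f0 i * g1 i + f1 i * g0 i) / 2 - (f0 i * g0 i + f1 i * g1 i) / 2
      ≤ (√(f0 i * g1 i) - √(f0 i * g0 i)) ^ 2 + (√(f1 i * g0 i) - √(f0 i * g0 i)) ^ 2 := by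
    intro i
    have sq : ∀ x : ℝ, 0 ≤ x → ∃ a, 0 ≤ a ∧ x = a ^ 2 :=
      fun x hx => ⟨√x, Real.sqrt_nonneg _, (Real.sq_sqrt hx).symm⟩
    obtain ⟨a, ha, ea⟩ := sq _ (hf0 i)
    obtain ⟨b, hb, eb⟩ := sq _ (hf1 i)
    obtain ⟨c, hc, ec⟩ := sq _ (hg0 i)
    obtain ⟨d, hd, ed⟩ := sq _ (hg1 i)
    rw [ea, eb, ec, ed]
    simp only [← mul_pow, Real.sqrt_sq (mul_nonneg ha hc), Real.sqrt_sq (mul_nonneg ha hd),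
      Real.sqrt_sq (mul_nonneg hb hc)]
    -- The rank-one identity `(a * d) * (b * c) = (a * c) * (b * d)` makes the slack half the sum of
    -- these two squares.
    nlinarith [sq_nonneg (a * d + b * c - 2 * (a * c)), sq_nonneg (a * c - b * d)]
  have := Finset.sum_le_sum fun i (_ : i ∈ Finset.univ) => key i
  rw [Finset.sum_sub_distrib, ← Finset.sum_div, ← Finset.sum_div, Finset.sum_add_distrib,
    Finset.sum_add_distrib, h00, h01, h10, h11] at this
  linarith

/-! ### The lower bound and its asymptotic forms. -/

/-- A size-`r` nonnegative factorization of a `ρ`-extension of UDISJ has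
`log r ≥ n / (16 ρ)`. -/
theorem IsUDISJExtension.le_log_of_hasNonnegFactorization {n r : ℕ} {ρ : ℝ} (hρ : 0 < ρ)
    {M : Matrix (Finset (Fin n)) (Finset (Fin n)) ℝ} (hM : IsUDISJExtension n ρ M)
    (hr : HasNonnegFactorization M r) : n / (16 * ρ) ≤ Real.log r := by
  obtain ⟨T, U, hT, hU, rfl⟩ := hr
  obtain ⟨hM0, hM1⟩ := hM
  let v : Fin r → Finset (Fin n) → ℝ := fun i b => U i b / ρ
  have hv : ∀ i b, 0 ≤ v i b := fun i b => div_nonneg (hU i b) hρ.le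
  have hs : ∀ a b, ∑ i, T a i * v i b = (T * U) a b / ρ := by
    intro a b
    simp only [v, Matrix.mul_apply, Finset.sum_div, mul_div_assoc]
  have hs0 : ∀ a b, a ∩ b = ∅ → ∑ i, T a i * v i b = 1 := by
    intro a b h
    rw [hs, hM0 a b (by simp [h]), div_self hρ.ne']
  let w : Finset (Fin n) → Fin r → Finset (Fin n) → ℝ := fun d i c => T (c ∩ d) i * v i (c \ d)
  have hw : ∀ d i c, 0 ≤ w d i c := fun d i c => mul_nonneg (hT _ _) (hv _ _)
  have hw1 : ∀ d c, ∑ i, w d i c = 1 := fun d c => hs0 _ _ (by grind)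
  let G : Fin n → Finset (Fin n) → ℝ := fun j d =>
    ∑ i, twoPointEnt (𝔼 c, w d i (insert j c)) (𝔼 c, w d i (Finset.erase c j))
  have upper : ∀ d, ∑ j, G j d ≤ Real.log r := by
    intro d
    rw [Finset.sum_comm]
    exact (Finset.sum_le_sum fun i _ => sum_twoPointEnt_le _ (hw d i)).trans
      (sum_entropy_le_log (w d) (hw d) (hw1 d))
  have lower : ∀ j d, 1 / (8 * ρ) ≤ G j (insert j d) + G j (Finset.erase d j) := by
    intro j d
    set d' := Finset.erase d j with hd'
    have hins : insert j d = insert j d' := by rw [hd']; grind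
    have hj : j ∉ d' := Finset.notMem_erase j d
    -- Only `j ∉ d'` matters from here: under `d'` flipping `j` in `c` changes the second set, under
    -- `insert j d'` the first.
    rw [hins]
    clear_value d'
    let f0 : Fin r → ℝ := fun i => 𝔼 c, T (Finset.erase (c ∩ d') j) i
    let f1 : Fin r → ℝ := fun i => 𝔼 c, T (insert j (c ∩ d')) i
    let g0 : Fin r → ℝ := fun i => 𝔼 c, v i (Finset.erase (c \ d') j)
    let g1 : Fin r → ℝ := fun i => 𝔼 c, v i (insert j (c \ d'))
    have p00 : ∀ i, f0 i * g0 i = 𝔼 c, T (Finset.erase (c ∩ d') j) i * v i (Finset.erase (c \ d') j) :=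
      fun i => (expect_inter_mul_sdiff (fun s => T (s.erase j) i) (fun s => v i (s.erase j))
        d').symm
    have p01 : ∀ i, f0 i * g1 i = 𝔼 c, T (Finset.erase (c ∩ d') j) i * v i (insert j (c \ d')) :=
      fun i => (expect_inter_mul_sdiff (fun s => T (s.erase j) i) (fun s => v i (insert j s))
        d').symm
    have p10 : ∀ i, f1 i * g0 i = 𝔼 c, T (insert j (c ∩ d')) i * v i (Finset.erase (c \ d') j) :=
      fun i => (expect_inter_mul_sdiff (fun s => T (insert j s) i) (fun s => v i (s.erase j))
        d').symm
    have p11 : ∀ i, f1 i * g1 i = 𝔼 c, T (insert j (c ∩ d')) i * v i (insert j (c \ d')) :=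
      fun i => (expect_inter_mul_sdiff (fun s => T (insert j s) i) (fun s => v i (insert j s))
        d').symm
    have mass : ∀ (a b : Finset (Fin n) → Finset (Fin n)) (t : ℝ),
        (∀ c, ∑ i, T (a c) i * v i (b c) = t) → ∑ i, 𝔼 c, T (a c) i * v i (b c) = t := by
      intro a b t h
      rw [← Finset.expect_sum_comm, Finset.expect_congr rfl fun c _ => h c]
      exact Finset.expect_const Finset.univ_nonempty t
    have H := half_le_sum_sq_sqrt_sub_sqrt f0 f1 g0 g1 (1 / ρ)
      (fun i => Finset.expect_nonneg fun c _ => hT _ _)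
      (fun i => Finset.expect_nonneg fun c _ => hT _ _)
      (fun i => Finset.expect_nonneg fun c _ => hv _ _)
      (fun i => Finset.expect_nonneg fun c _ => hv _ _)
      (by
        rw [Finset.sum_congr rfl fun i _ => p00 i]
        exact mass _ _ _ fun c => hs0 _ _ (by grind))
      (by
        rw [Finset.sum_congr rfl fun i _ => p01 i]
        exact mass _ _ _ fun c => hs0 _ _ (by grind))
      (by
        rw [Finset.sum_congr rfl fun i _ => p10 i]
        exact mass _ _ _ fun c => hs0 _ _ (by grind))
      (by
        rw [Finset.sum_congr rfl fun i _ => p11 i]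
        refine mass _ _ _ fun c => ?_
        have hint : insert j (c ∩ d') ∩ insert j (c \ d') = {j} := by grind
        rw [hs, hM1 _ _ (by rw [hint, Finset.card_singleton]), sub_div, div_self hρ.ne'])
    have e1 : ∀ i, twoPointEnt (𝔼 c, w d' i (insert j c)) (𝔼 c, w d' i (Finset.erase c j))
        = twoPointEnt (f0 i * g1 i) (f0 i * g0 i) := by
      intro i
      rw [p01, p00]
      congr 1 <;> refine Finset.expect_congr rfl fun c _ => ?_ <;> simp only [w] <;> congr 2 <;>
        ext x <;> by_cases hx : x = j <;> simp [hx, hj]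
    have e2 : ∀ i, twoPointEnt (𝔼 c, w (insert j d') i (insert j c))
        (𝔼 c, w (insert j d') i (Finset.erase c j)) = twoPointEnt (f1 i * g0 i) (f0 i * g0 i) := by
      intro i
      rw [p10, p00]
      congr 1 <;> refine Finset.expect_congr rfl fun c _ => ?_ <;> simp only [w] <;> congr 2 <;>
        ext x <;> by_cases hx : x = j <;> simp [hx, hj]
    have nn : ∀ i, 0 ≤ f0 i * g0 i ∧ 0 ≤ f0 i * g1 i ∧ 0 ≤ f1 i * g0 i := by
      intro i
      rw [p00, p01, p10]
      exact ⟨Finset.expect_nonneg fun c _ => mul_nonneg (hT _ _) (hv _ _),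
        Finset.expect_nonneg fun c _ => mul_nonneg (hT _ _) (hv _ _),
        Finset.expect_nonneg fun c _ => mul_nonneg (hT _ _) (hv _ _)⟩
    have H2 : (∑ i, ((√(f0 i * g1 i) - √(f0 i * g0 i)) ^ 2
        + (√(f1 i * g0 i) - √(f0 i * g0 i)) ^ 2)) / 4 ≤ G j (insert j d') + G j d' := by
      simp only [G]
      rw [← Finset.sum_add_distrib, Finset.sum_div]
      refine Finset.sum_le_sum fun i _ => ?_
      rw [e1, e2]
      linarith [sq_sqrt_sub_sqrt_le_twoPointEnt (nn i).2.1 (nn i).1,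
        sq_sqrt_sub_sqrt_le_twoPointEnt (nn i).2.2 (nn i).1]
    -- The 2 comes from cut and paste, the 4 from the Hellinger bound; averaging over whether `j ∈
    -- d` later doubles 8 to 16.
    have e : 1 / (8 * ρ) = 1 / ρ / 2 / 4 := by field_simp; norm_num
    rw [e]
    linarith
  have lower' : ∀ j, 1 / (16 * ρ) ≤ 𝔼 d, G j d := by
    intro j
    rw [expect_eq_insert_erase _ j, ← Finset.expect_add_distrib]
    have : 1 / (8 * ρ) ≤ 𝔼 d, (G j (insert j d) + G j (Finset.erase d j)) := by
      rw [← Finset.expect_const (s := (Finset.univ : Finset (Finset (Fin n))))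
        Finset.univ_nonempty (1 / (8 * ρ))]
      exact Finset.expect_le_expect fun d _ => lower j d
    have e : 1 / (16 * ρ) = 1 / (8 * ρ) / 2 := by field_simp; norm_num
    rw [e]
    linarith
  calc n / (16 * ρ) = ∑ _j : Fin n, 1 / (16 * ρ) := by simp [div_eq_mul_inv]
    _ ≤ ∑ j, 𝔼 d, G j d := Finset.sum_le_sum fun j _ => lower' j
    _ = 𝔼 d, ∑ j, G j d := (Finset.expect_sum_comm _ _ _).symm
    _ ≤ 𝔼 _d : Finset (Fin n), Real.log r := Finset.expect_le_expect fun d _ => upper d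
    _ = Real.log r := Finset.expect_const Finset.univ_nonempty _

/-- The nonnegative rank of a `ρ`-extension of UDISJ is at least `2 ^ (n / (16 ρ))`. -/
theorem IsUDISJExtension.two_rpow_le_nonnegRank {n : ℕ} {ρ : ℝ} (hρ : 0 < ρ)
    {M : Matrix (Finset (Fin n)) (Finset (Fin n)) ℝ} (hM : IsUDISJExtension n ρ M)
    (hnn : ∀ a b, 0 ≤ M a b) : (2 : ℝ) ^ (n / (16 * ρ)) ≤ nonnegRank M := by
  have hfac := hasNonnegFactorization_nonnegRank M hnn
  have h := hM.le_log_of_hasNonnegFactorization hρ hfac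
  have hpos : (0 : ℝ) < nonnegRank M := by
    rcases Nat.eq_zero_or_pos (nonnegRank M) with h0 | h0
    · rw [h0] at hfac
      obtain ⟨T, U, -, -, e⟩ := hfac
      have h1 := hM.1 ∅ ∅ (by simp)
      rw [e, Matrix.mul_apply, Finset.univ_eq_empty, Finset.sum_empty] at h1
      exact absurd h1 hρ.ne
    · exact_mod_cast h0
  rw [← Real.log_le_log_iff (by positivity) hpos, Real.log_rpow two_pos]
  have hx : (0 : ℝ) ≤ n / (16 * ρ) := by positivity
  -- Passing from base `e` to base 2 only weakens the bound.
  have hlog : Real.log 2 ≤ 1 := by linarith [Real.log_two_lt_d9]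
  exact (mul_le_of_le_one_right hx hlog).trans h

theorem theorem3 :
    (∀ ρ : ℝ, ∃ c : ℝ, 0 < c ∧ ∃ n₀ : ℕ, ∀ n : ℕ, n₀ ≤ n →
      ∀ M : Matrix (Finset (Fin n)) (Finset (Fin n)) ℝ,
        (∀ a b, 0 ≤ M a b) → IsUDISJExtension n ρ M →
          (2 : ℝ) ^ (c * (n : ℝ)) ≤ (nonnegRank M : ℝ)) ∧
    (∀ β : ℝ, β < 1 / 2 → ∀ C : ℝ, ∃ c : ℝ, 0 < c ∧ ∃ n₀ : ℕ, ∀ n : ℕ, n₀ ≤ n →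
      ∀ ρ : ℝ, ρ ≤ C * (n : ℝ) ^ β →
      ∀ M : Matrix (Finset (Fin n)) (Finset (Fin n)) ℝ,
        (∀ a b, 0 ≤ M a b) → IsUDISJExtension n ρ M →
          (2 : ℝ) ^ (c * (n : ℝ) ^ (1 - 2 * β)) ≤ (nonnegRank M : ℝ)) := by
  have main : ∀ β : ℝ, β < 1 / 2 → ∀ C : ℝ, ∃ c : ℝ, 0 < c ∧ ∃ n₀ : ℕ, ∀ n : ℕ, n₀ ≤ n →
      ∀ ρ : ℝ, ρ ≤ C * (n : ℝ) ^ β →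
      ∀ M : Matrix (Finset (Fin n)) (Finset (Fin n)) ℝ,
        (∀ a b, 0 ≤ M a b) → IsUDISJExtension n ρ M →
          (2 : ℝ) ^ (c * (n : ℝ) ^ (1 - 2 * β)) ≤ (nonnegRank M : ℝ) := by
    intro β _ C
    -- The summand 1 keeps the denominator positive when `C = 0`.
    refine ⟨1 / (16 * (1 + C ^ 2)), by positivity, 1, fun n hn ρ hρC M hnn hM => ?_⟩
    have hρ1 : 1 ≤ ρ := by
      have h := hM.2 {⟨0, hn⟩} {⟨0, hn⟩} (by simp)
      linarith [hnn {⟨0, hn⟩} {⟨0, hn⟩}]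
    have hρ : 0 < ρ := by linarith
    refine le_trans (Real.rpow_le_rpow_of_exponent_le one_le_two ?_)
      (hM.two_rpow_le_nonnegRank hρ hnn)
    have hn0 : (0 : ℝ) < n := by exact_mod_cast hn
    set x := (n : ℝ) ^ β with hx
    have hx0 : 0 < x := Real.rpow_pos_of_pos hn0 β
    have hpow : (n : ℝ) ^ (1 - 2 * β) = n / x ^ 2 := by
      rw [Real.rpow_sub hn0, Real.rpow_one, mul_comm 2 β, Real.rpow_mul hn0.le, hx]
      norm_num
    rw [hpow, div_mul_div_comm, one_mul, div_le_div_iff₀ (by positivity) (by positivity)]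
    -- `1 ≤ ρ ≤ C * x` gives `ρ ≤ (C * x) ^ 2`.
    have : ρ ≤ (1 + C ^ 2) * x ^ 2 := by nlinarith [sq_nonneg (C * x - 1)]
    nlinarith
  refine ⟨fun ρ => ?_, main⟩
  obtain ⟨c, hc, n₀, h⟩ := main 0 (by norm_num) ρ
  refine ⟨c, hc, n₀, fun n hn M hnn hM => ?_⟩
  simpa using h n hn ρ (by simp) M hnn hM
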